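/- For $n\in\mathbb N$ let $L_n$ be the path graph with vertices $1,\dots,n$ and edges $\{i,i+1\}$ ($1\le i<n$), with its path distance $d$, and let $B(x,k)=\{y: d(x,y)\le k\}$. A measure $\mu$ on $L_n$ is given by a weight function $\mu:\{1,\dots,n\}\to(0,\infty)$, with $\mu(A)=\sum_{v\in A}\mu(v)$. Its doubling constant is $$C_\mu=\sup_{x,\;r>0}\frac{\mu(\{y:d(x,y)<2r\})}{\mu(\{y:d(x,y)<r\})},$$ where $x$ runs over the vertices and $r$ over the positive reals; put $C_{L_n}=\inf_\mu C_\mu$, the infimum being over all measures on $L_n$. A doubling minimizer on $L_n$ is a measure $\mu$ with $C_\mu=C_{L_n}$. Theorem. For every integer $n\ge 3$ there exist integers $j$ and $k$ with $2\le j\le\lceil n/2\rceil$ and $0\le k<\lceil (n-2)/3\rceil$ such that every doubling minimizer $\mu$ on $L_n$ satisfies $$\frac{\mu(B(j,1))}{\mu(j)}=\frac{\mu(B(1,2k+1))}{\mu(B(1,k))}=C_\mu .$$ -/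

import Mathlib

noncomputable section

namespace PathDoubling

variable {V : Type*}

/-- The open ball `{y | d(x,y) < r}` of a connected graph for the path distance. -/
def openBall (G : SimpleGraph V) (x : V) (r : ℝ) : Set V :=
  {y | (G.dist x y : ℝ) < r}

/-- The closed ball `B(x,k) = {y | d(x,y) ≤ k}` of a connected graph for the path distance. -/
def closedBall (G : SimpleGraph V) (x : V) (k : ℕ) : Set V :=
  {y | G.dist x y ≤ k}

/-- The mass `μ(A) = ∑ v ∈ A, μ(v)` of a set of vertices, for a weight function `μ`. -/
def mass [Fintype V] (μ : V → ℝ) (A : Set V) : ℝ :=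
  ∑ v, A.indicator μ v

/-- All the quotients `μ(B(x,2r)) / μ(B(x,r))` over open balls of radius `r > 0`. -/
def doublingQuotients [Fintype V] (G : SimpleGraph V) (μ : V → ℝ) : Set ℝ :=
  {q | ∃ (x : V) (r : ℝ), 0 < r ∧
    q = mass μ (openBall G x (2 * r)) / mass μ (openBall G x r)}

/-- A doubling measure on a graph: a strictly positive weight function on the vertices
whose doubling quotients are bounded. -/
structure IsDoubling [Fintype V] (G : SimpleGraph V) (μ : V → ℝ) : Prop where
  pos : ∀ v, 0 < μ v
  bddAbove : BddAbove (doublingQuotients G μ)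

/-- The doubling constant `C_μ`. -/
def doublingConst [Fintype V] (G : SimpleGraph V) (μ : V → ℝ) : ℝ :=
  sSup (doublingQuotients G μ)

/-- The least doubling constant `C_G = inf C_μ` over all doubling measures `μ` on `G`. -/
def leastDoublingConst [Fintype V] (G : SimpleGraph V) : ℝ :=
  sInf {C | ∃ μ : V → ℝ, IsDoubling G μ ∧ C = doublingConst G μ}

/-- A doubling minimizer of `G`: a doubling measure with `C_μ = C_G`. -/
def IsDoublingMinimizer [Fintype V] (G : SimpleGraph V) (μ : V → ℝ) : Prop :=
  IsDoubling G μ ∧ doublingConst G μ = leastDoublingConst G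

end PathDoubling

end

/-! Write C for the least doubling constant; call a ball tight for a minimizer when its quotient
equals C. The conditions "all quotients are at most C" are linear in the weights, so minimizers are
closed under addition, and the tight balls of a sum are those tight for both summands. Hence some
minimizer has only tight balls common to all minimizers (`exists_isTight_imp`). Adding its mirror
image makes it symmetric and keeps this property, so it suffices to locate tight balls of one
symmetric minimizer.

Perturbation locates them: no direction strictly relaxes every tight condition at once
(`exists_isTight_le`). Moving off the uniform weight in this way gives C < 3, so a symmetric
minimizer, extended by zero to 0 and n + 1, is concave. Two inequalities near the end give C > 7/3,
and comparison with a chord then excludes tight balls of positive radius about interior vertices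
(`intervalSum_lt`). Balls about an end are excluded once 3k + 2 ≥ n (`intervalSum_lt_of_le_right`).
Finally, adding mass at the two ends relaxes every remaining end condition, so some interior ball of
radius 0 is tight; removing mass uniformly relaxes every interior condition, so some end ball is
tight. -/

namespace PathDoubling

/-! ### Tight balls and perturbation of minimizers on finite graphs -/

section General

theorem openBall_natCast_add_one {V : Type*} (G : SimpleGraph V) (x : V) (k : ℕ) :
    openBall G x (k + 1) = closedBall G x k := by
  ext y
  simp only [openBall, closedBall, Set.mem_ofPred_eq]
  norm_cast
  exact Nat.lt_succ_iff

variable {V : Type*} [Fintype V] {G : SimpleGraph V} {μ ν : V → ℝ}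

theorem mass_add (μ ν : V → ℝ) (A : Set V) : mass (μ + ν) A = mass μ A + mass ν A := by
  simp only [mass, Set.indicator_add', Pi.add_apply, Finset.sum_add_distrib]

theorem mass_add_smul (μ ν : V → ℝ) (t : ℝ) (A : Set V) :
    mass (fun v => μ v + t * ν v) A = mass μ A + t * mass ν A := by
  simp only [mass, Finset.mul_sum, ← Finset.sum_add_distrib]
  refine Finset.sum_congr rfl fun v _ => ?_
  by_cases hv : v ∈ A <;> simp [hv]

theorem mass_mono (hμ : ∀ v, 0 < μ v) {A B : Set V} (h : A ⊆ B) : mass μ A ≤ mass μ B :=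
  Finset.sum_le_sum fun v _ => Set.indicator_le_indicator_of_subset h (fun v => (hμ v).le) v

theorem mass_pos (hμ : ∀ v, 0 < μ v) {A : Set V} {x : V} (hx : x ∈ A) : 0 < mass μ A := by
  refine Finset.sum_pos' (fun v _ => Set.indicator_nonneg (fun v _ => (hμ v).le) v)
    ⟨x, Finset.mem_univ x, ?_⟩
  rw [Set.indicator_of_mem hx]
  exact hμ x

theorem mass_closedBall_pos (hμ : ∀ v, 0 < μ v) (x : V) (k : ℕ) :
    0 < mass μ (closedBall G x k) :=
  mass_pos hμ (x := x) (by simp [closedBall])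

theorem mass_openBall_pos (hμ : ∀ v, 0 < μ v) (x : V) {r : ℝ} (hr : 0 < r) :
    0 < mass μ (openBall G x r) :=
  mass_pos hμ (x := x) (by simpa [openBall] using hr)

theorem doublingQuotients_finite (G : SimpleGraph V) (μ : V → ℝ) :
    (doublingQuotients G μ).Finite := by
  refine (Set.finite_range fun p : Set V × Set V => mass μ p.1 / mass μ p.2).subset ?_
  rintro q ⟨x, r, -, rfl⟩
  exact ⟨(_, _), rfl⟩

theorem doublingQuotients_nonempty [Nonempty V] (G : SimpleGraph V) (μ : V → ℝ) :
    (doublingQuotients G μ).Nonempty :=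
  ⟨_, Classical.arbitrary V, 1, one_pos, rfl⟩

theorem isDoubling_of_pos (hμ : ∀ v, 0 < μ v) : IsDoubling G μ :=
  ⟨hμ, (doublingQuotients_finite G μ).bddAbove⟩

theorem mass_closedBall_le (hμ : ∀ v, 0 < μ v) (x : V) (k : ℕ) :
    mass μ (closedBall G x (2 * k + 1)) ≤ doublingConst G μ * mass μ (closedBall G x k) := by
  rw [← div_le_iff₀ (mass_closedBall_pos hμ x k)]
  refine le_csSup (doublingQuotients_finite G μ).bddAbove ⟨x, k + 1, by positivity, ?_⟩
  rw [← openBall_natCast_add_one, ← openBall_natCast_add_one]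
  push_cast
  ring_nf

/-- The doubling constant is attained at a pair of closed balls, up to inequality. -/
theorem exists_doublingConst_mul_le [Nonempty V] (hμ : ∀ v, 0 < μ v) :
    ∃ (x : V) (k : ℕ), doublingConst G μ * mass μ (closedBall G x k) ≤
      mass μ (closedBall G x (2 * k + 1)) := by
  obtain ⟨x, r, hr, hq⟩ :=
    (doublingQuotients_nonempty G μ).csSup_mem (doublingQuotients_finite G μ)
  -- For k < r ≤ k + 1, replacing r by k + 1 keeps the small ball and can only enlarge the doubled
  -- one.
  obtain ⟨k, hk⟩ : ∃ k : ℕ, ⌈r⌉₊ = k + 1 :=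
    Nat.exists_eq_add_one_of_ne_zero (Nat.ceil_pos.2 hr).ne'
  have hrk : r ≤ k + 1 := by exact_mod_cast hk ▸ Nat.le_ceil r
  have hkr : (k : ℝ) < r := Nat.lt_ceil.1 (by omega)
  refine ⟨x, k, ?_⟩
  have h1 : closedBall G x k ⊆ openBall G x r := by
    intro y hy
    have : (G.dist x y : ℝ) ≤ k := by exact_mod_cast hy
    exact this.trans_lt hkr
  have h2 : openBall G x (2 * r) ⊆ closedBall G x (2 * k + 1) := by
    intro y hy
    have : (G.dist x y : ℝ) < 2 * r := hy
    have h : (G.dist x y : ℝ) < ((2 * k + 2 : ℕ) : ℝ) := by push_cast; linarith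
    have h' : G.dist x y < 2 * k + 2 := by exact_mod_cast h
    exact Nat.lt_succ_iff.1 h'
  have hpos : 0 < mass μ (openBall G x r) := mass_openBall_pos hμ x hr
  have hC : doublingConst G μ * mass μ (openBall G x r) = mass μ (openBall G x (2 * r)) := by
    rw [doublingConst, hq, div_mul_cancel₀ _ hpos.ne']
  have h0 : 0 ≤ doublingConst G μ := by
    rw [doublingConst, hq]
    exact div_nonneg (mass_openBall_pos hμ x (by positivity)).le hpos.le
  calc doublingConst G μ * mass μ (closedBall G x k)
      ≤ doublingConst G μ * mass μ (openBall G x r) :=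
        mul_le_mul_of_nonneg_left (mass_mono hμ h1) h0
    _ = mass μ (openBall G x (2 * r)) := hC
    _ ≤ _ := mass_mono hμ h2

theorem doublingConst_le [Nonempty V] (hμ : ∀ v, 0 < μ v) {D : ℝ}
    (h : ∀ x k, mass μ (closedBall G x (2 * k + 1)) ≤ D * mass μ (closedBall G x k)) :
    doublingConst G μ ≤ D := by
  obtain ⟨x, k, hk⟩ := exists_doublingConst_mul_le (G := G) hμ
  exact le_of_mul_le_mul_right (hk.trans (h x k)) (mass_closedBall_pos hμ x k)

theorem doublingConst_pos [Nonempty V] (hμ : ∀ v, 0 < μ v) : 0 < doublingConst G μ := by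
  have x := Classical.arbitrary V
  exact pos_of_mul_pos_left
    ((mass_closedBall_pos hμ x (2 * 0 + 1)).trans_le (mass_closedBall_le (G := G) hμ x 0))
    (mass_closedBall_pos hμ x 0).le

theorem leastDoublingConst_le [Nonempty V] (hμ : ∀ v, 0 < μ v) :
    leastDoublingConst G ≤ doublingConst G μ := by
  refine csInf_le ⟨0, ?_⟩ ⟨μ, isDoubling_of_pos hμ, rfl⟩
  rintro _ ⟨ν, hν, rfl⟩
  exact (doublingConst_pos hν.pos).le

theorem isDoublingMinimizer_of_le [Nonempty V] (hμ : ∀ v, 0 < μ v)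
    (h : ∀ x k, mass μ (closedBall G x (2 * k + 1)) ≤
      leastDoublingConst G * mass μ (closedBall G x k)) : IsDoublingMinimizer G μ :=
  ⟨isDoubling_of_pos hμ, (doublingConst_le hμ h).antisymm (leastDoublingConst_le hμ)⟩

/-- The ball `B(x,k)` realizes the quotient `C_G` for the weight function `μ`. -/
def IsTight (G : SimpleGraph V) (μ : V → ℝ) (x : V) (k : ℕ) : Prop :=
  mass μ (closedBall G x (2 * k + 1)) = leastDoublingConst G * mass μ (closedBall G x k)

namespace IsDoublingMinimizer

theorem mass_le (hμ : IsDoublingMinimizer G μ) (x : V) (k : ℕ) :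
    mass μ (closedBall G x (2 * k + 1)) ≤ leastDoublingConst G * mass μ (closedBall G x k) :=
  hμ.2 ▸ mass_closedBall_le hμ.1.pos x k

/-- No direction improves every tight constraint of a minimizer. -/
theorem exists_isTight_le [Nonempty V] (hμ : IsDoublingMinimizer G μ) (ν : V → ℝ) :
    ∃ x k, IsTight G μ x k ∧ leastDoublingConst G * mass ν (closedBall G x k) ≤
      mass ν (closedBall G x (2 * k + 1)) := by
  by_contra! hcon
  set C := leastDoublingConst G with hC
  have key : ∀ a b : ℝ, 0 ≤ a → (a = 0 → 0 < b) →
      ∀ᶠ t : ℝ in nhdsWithin 0 (Set.Ioi 0), 0 < a + t * b := by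
    intro a b ha hab
    rcases ha.eq_or_lt with rfl | ha
    · filter_upwards [self_mem_nhdsWithin] with t ht
      have := mul_pos (Set.mem_Ioi.1 ht) (hab rfl)
      linarith
    · have : Filter.Tendsto (fun t : ℝ => a + t * b) (nhdsWithin 0 (Set.Ioi 0)) (nhds a) := by
        have h : Continuous fun t : ℝ => a + t * b := by fun_prop
        simpa using (h.tendsto 0).mono_left nhdsWithin_le_nhds
      exact this.eventually (lt_mem_nhds ha)
  have h1 : ∀ᶠ t : ℝ in nhdsWithin 0 (Set.Ioi 0), ∀ v, 0 < μ v + t * ν v :=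
    Filter.eventually_all.2 fun v => key _ _ (hμ.1.pos v).le fun h => absurd h (hμ.1.pos v).ne'
  -- Indexing the conditions by pairs of sets, not by centre and radius, leaves finitely many, so a
  -- single small t serves for all of them.
  have h2 : ∀ᶠ t : ℝ in nhdsWithin 0 (Set.Ioi 0), ∀ p : Set V × Set V,
      (0 ≤ C * mass μ p.1 - mass μ p.2 ∧
        (C * mass μ p.1 - mass μ p.2 = 0 → 0 < C * mass ν p.1 - mass ν p.2)) →
      0 < (C * mass μ p.1 - mass μ p.2) + t * (C * mass ν p.1 - mass ν p.2) := by
    refine Filter.eventually_all.2 fun p => ?_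
    by_cases hp : (0 ≤ C * mass μ p.1 - mass μ p.2 ∧
        (C * mass μ p.1 - mass μ p.2 = 0 → 0 < C * mass ν p.1 - mass ν p.2))
    · exact (key _ _ hp.1 hp.2).mono fun t ht _ => ht
    · exact Filter.Eventually.of_forall fun t h => absurd h hp
  obtain ⟨t, ht1, ht2⟩ := (h1.and h2).exists
  obtain ⟨x, k, hxk⟩ := exists_doublingConst_mul_le (G := G) ht1
  have hp := mass_closedBall_pos (G := G) ht1 x k
  have hle := mul_le_mul_of_nonneg_right (leastDoublingConst_le (G := G) ht1) hp.le
  have := ht2 (closedBall G x k, closedBall G x (2 * k + 1))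
    ⟨sub_nonneg.2 (hμ.mass_le x k), fun h => sub_pos.2 (hcon x k (sub_eq_zero.1 h).symm)⟩
  simp only [mass_add_smul] at hle hxk this
  rw [← hC] at hle
  linarith

theorem add [Nonempty V] (hμ : IsDoublingMinimizer G μ) (hν : IsDoublingMinimizer G ν) :
    IsDoublingMinimizer G (μ + ν) := by
  refine isDoublingMinimizer_of_le (fun v => add_pos (hμ.1.pos v) (hν.1.pos v)) fun x k => ?_
  rw [mass_add, mass_add, mul_add]
  exact add_le_add (hμ.mass_le x k) (hν.mass_le x k)

theorem isTight_of_add (hμ : IsDoublingMinimizer G μ) (hν : IsDoublingMinimizer G ν)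
    {x : V} {k : ℕ} (h : IsTight G (μ + ν) x k) : IsTight G μ x k ∧ IsTight G ν x k := by
  unfold IsTight at *
  rw [mass_add, mass_add, mul_add] at h
  have h1 := hμ.mass_le x k
  have h2 := hν.mass_le x k
  constructor <;> linarith

theorem div_eq_of_isTight (hμ : IsDoublingMinimizer G μ) {x : V} {k : ℕ} (h : IsTight G μ x k) :
    mass μ (closedBall G x (2 * k + 1)) / mass μ (closedBall G x k) = doublingConst G μ := by
  rw [h, hμ.2, mul_div_cancel_right₀ _ (mass_closedBall_pos hμ.1.pos x k).ne']

end IsDoublingMinimizer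

/-- If there are minimizers, one of them has only the constraints tight
that are tight for all minimizers. -/
theorem exists_isTight_imp [Nonempty V] (hμ : IsDoublingMinimizer G μ) :
    ∃ μ₀, IsDoublingMinimizer G μ₀ ∧ ∀ ν, IsDoublingMinimizer G ν →
      ∀ x k, IsTight G μ₀ x k → IsTight G ν x k := by
  classical
  -- Radii range over all of ℕ; recording the balls as sets makes inclusion of tight families well
  -- founded.
  let T : (V → ℝ) → Set (Set V × Set V) := fun μ =>
    {p | ∃ x k, p = (closedBall G x k, closedBall G x (2 * k + 1)) ∧ IsTight G μ x k}
  obtain ⟨_, ⟨μ₀, h₀, rfl⟩, hmin⟩ := (wellFounded_lt (α := Set (Set V × Set V))).has_min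
    (T '' {μ | IsDoublingMinimizer G μ}) ⟨_, μ, hμ, rfl⟩
  refine ⟨μ₀, h₀, fun ν hν x k hxk => ?_⟩
  have hsub : T (μ₀ + ν) ⊆ T μ₀ := by
    rintro _ ⟨y, l, rfl, hl⟩
    exact ⟨y, l, rfl, (h₀.isTight_of_add hν hl).1⟩
  have hsup : T μ₀ ⊆ T (μ₀ + ν) := by
    by_contra hn
    exact hmin _ ⟨_, h₀.add hν, rfl⟩ ⟨hsub, hn⟩
  obtain ⟨y, l, hyl, hl⟩ := hsup ⟨x, k, rfl, hxk⟩
  have hl' := (h₀.isTight_of_add hν hl).2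
  unfold IsTight at *
  rw [Prod.mk.injEq] at hyl
  rwa [hyl.1, hyl.2]

theorem mass_comp (φ : V ≃ V) (hφ : ∀ x y, G.dist (φ x) (φ y) = G.dist x y) (μ : V → ℝ)
    (x : V) (k : ℕ) : mass (μ ∘ φ) (closedBall G x k) = mass μ (closedBall G (φ x) k) := by
  refine Fintype.sum_equiv φ _ _ fun v => ?_
  simp only [Set.indicator, closedBall, Set.mem_ofPred_eq, hφ, Function.comp_apply]
  congr

theorem IsDoublingMinimizer.comp [Nonempty V] (hμ : IsDoublingMinimizer G μ) (φ : V ≃ V)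
    (hφ : ∀ x y, G.dist (φ x) (φ y) = G.dist x y) : IsDoublingMinimizer G (μ ∘ φ) := by
  refine isDoublingMinimizer_of_le (fun v => hμ.1.pos _) fun x k => ?_
  rw [mass_comp φ hφ, mass_comp φ hφ]
  exact hμ.mass_le _ k

end General

/-! ### Sums over integer intervals -/

section IntervalSum

/-- The sum of `f` over the integers of `[a, b]`. -/
noncomputable def intervalSum (f : ℤ → ℝ) (a b : ℤ) : ℝ :=
  ∑ y ∈ Finset.Icc a b, f y

theorem intervalSum_succ_right (f : ℤ → ℝ) {a b : ℤ} (h : a ≤ b + 1) :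
    intervalSum f a (b + 1) = intervalSum f a b + f (b + 1) := by
  have : Finset.Icc a (b + 1) = insert (b + 1) (Finset.Icc a b) := by
    ext y; simp only [Finset.mem_Icc, Finset.mem_insert]; omega
  rw [intervalSum, this, Finset.sum_insert (by simp), intervalSum, add_comm]

theorem intervalSum_self (f : ℤ → ℝ) (a : ℤ) : intervalSum f a a = f a := by
  simp [intervalSum]

theorem intervalSum_three (f : ℤ → ℝ) (a : ℤ) :
    intervalSum f (a - 1) (a + 1) = f (a - 1) + f a + f (a + 1) := by
  have h := intervalSum_succ_right f (a := a - 1) (b := a - 1) (by omega)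
  rw [sub_add_cancel, intervalSum_self] at h
  rw [intervalSum_succ_right f (by omega), h]

theorem intervalSum_mono_set {f : ℤ → ℝ} {a b a' b' : ℤ} (ha : a' ≤ a) (hb : b ≤ b')
    (h : ∀ y, a' ≤ y → y ≤ b' → 0 ≤ f y) : intervalSum f a b ≤ intervalSum f a' b' :=
  Finset.sum_le_sum_of_subset_of_nonneg (Finset.Icc_subset_Icc ha hb) fun y hy _ => by
    rw [Finset.mem_Icc] at hy; exact h y hy.1 hy.2

theorem intervalSum_mono {f g : ℤ → ℝ} {a b : ℤ} (h : ∀ y, a ≤ y → y ≤ b → f y ≤ g y) :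
    intervalSum f a b ≤ intervalSum g a b :=
  Finset.sum_le_sum fun y hy => by rw [Finset.mem_Icc] at hy; exact h y hy.1 hy.2

theorem intervalSum_linear (p q : ℝ) (f g : ℤ → ℝ) (a b : ℤ) :
    intervalSum (fun y => p * f y + q * g y) a b =
      p * intervalSum f a b + q * intervalSum g a b := by
  simp only [intervalSum, Finset.sum_add_distrib, Finset.mul_sum]

theorem intervalSum_reflect (f : ℤ → ℝ) (c a b : ℤ) :
    intervalSum (fun y => f (c - y)) a b = intervalSum f (c - b) (c - a) := by
  refine Finset.sum_nbij' (fun y => c - y) (fun y => c - y) ?_ ?_ ?_ ?_ ?_ <;>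
    intro y hy <;> simp only [Finset.mem_Icc] at * <;> omega

theorem intervalSum_cast {a b : ℤ} (h : a ≤ b + 1) :
    intervalSum (fun y => (y : ℝ)) a b = ((a : ℝ) + b) * (b - a + 1) / 2 := by
  obtain ⟨m, hm⟩ := Int.eq_ofNat_of_zero_le (show 0 ≤ b + 1 - a by omega)
  obtain rfl : b = a + m - 1 := by omega
  clear h hm
  induction m with
  | zero => simp [intervalSum]
  | succ m ih =>
    have := intervalSum_succ_right (fun y => (y : ℝ)) (a := a) (b := a + m - 1) (by omega)
    rw [ih] at this
    rw [show a + ((m + 1 : ℕ) : ℤ) - 1 = a + m - 1 + 1 by push_cast; ring, this]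
    push_cast
    ring

/-- The doubling estimate for the identity, on balls not truncated by the origin. -/
theorem intervalSum_cast_le {x k : ℤ} (hk : 1 ≤ k) (hx : k + 2 ≤ x) :
    intervalSum (fun y => (y : ℝ)) (max 1 (x - (2 * k + 1))) (x + (2 * k + 1)) ≤
      7 / 3 * ((2 * k + 1) * x) := by
  have hk' : (1 : ℝ) ≤ k := by exact_mod_cast hk
  have hx' : (k : ℝ) + 2 ≤ x := by exact_mod_cast hx
  rcases le_total 1 (x - (2 * k + 1)) with h | h
  · rw [max_eq_right h, intervalSum_cast (by omega)]
    -- The sum is (4k + 3)x, and 3(4k + 3) ≤ 7(2k + 1) exactly when k ≥ 1; this is where 7/3 comes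
    -- from.
    push_cast
    nlinarith
  · rw [max_eq_left h, intervalSum_cast (by omega)]
    have h' : (x : ℝ) ≤ 2 * k + 2 := by exact_mod_cast (by omega : x ≤ 2 * k + 2)
    push_cast
    rcases (show x = 2 * k + 2 ∨ x ≤ 2 * k + 1 by omega) with rfl | h2
    · push_cast; nlinarith
    · have h3 : (x : ℝ) ≤ 2 * k + 1 := by exact_mod_cast h2
      -- The truncated sum is a convex quadratic in x, so it is controlled by its values at k + 2
      -- and 2k + 1.
      nlinarith [mul_nonneg (sub_nonneg.2 h3) (sub_nonneg.2 hx')]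

end IntervalSum

/-- A symmetric weight function on the integers of `(0, N)`, extended by zero, with all doubling
quotients at most `C ≤ 3`. -/
structure SymmFeasible (N : ℤ) (C : ℝ) (f : ℤ → ℝ) : Prop where
  four_le : 4 ≤ N
  le_three : C ≤ 3
  pos : ∀ y, 0 < y → y < N → 0 < f y
  eq_zero : ∀ y, y ≤ 0 ∨ N ≤ y → f y = 0
  symm : ∀ y, f (N - y) = f y
  le : ∀ x k, 0 < x → x < N → 0 ≤ k →
    intervalSum f (x - (2 * k + 1)) (x + (2 * k + 1)) ≤ C * intervalSum f (x - k) (x + k)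

/-! ### Concavity and strict quotient bounds for symmetric weights -/

namespace SymmFeasible

variable {N : ℤ} {C : ℝ} {f : ℤ → ℝ} (h : SymmFeasible N C f)
include h

theorem nonneg (y : ℤ) : 0 ≤ f y := by
  by_cases hy : 0 < y ∧ y < N
  · exact (h.pos y hy.1 hy.2).le
  · rw [h.eq_zero y (by omega)]

theorem mono {a b a' b' : ℤ} (ha : a' ≤ a) (hb : b ≤ b') :
    intervalSum f a b ≤ intervalSum f a' b' :=
  intervalSum_mono_set ha hb fun y _ _ => h.nonneg y

theorem clamp (a b : ℤ) :
    intervalSum f a b = intervalSum f (max 1 a) (min (N - 1) b) := by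
  refine (Finset.sum_subset (Finset.Icc_subset_Icc (le_max_right _ _) (min_le_right _ _)) ?_).symm
  intro y hy hy'
  rw [Finset.mem_Icc] at hy hy'
  exact h.eq_zero y (by omega)

theorem three_le {x : ℤ} (hx : 0 < x) (hxN : x < N) : f (x - 1) + f x + f (x + 1) ≤ C * f x := by
  have := h.le x 0 hx hxN le_rfl
  simpa [intervalSum_three, intervalSum_self] using this

/-- Discrete concavity: the radius-0 condition bounds the two neighbours by (C - 1) f x, and C ≤ 3.
-/
theorem slope_succ_le {x : ℤ} (hx : 0 < x) (hxN : x < N) : f (x + 1) - f x ≤ f x - f (x - 1) := by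
  have h1 := h.three_le hx hxN
  have h2 := mul_le_mul_of_nonneg_right h.le_three (h.nonneg x)
  linarith

theorem le_add_slope_mul {b : ℤ} (hb : 0 ≤ b) (m : ℕ) (hm : b + m ≤ N) :
    f (b + m) ≤ f b + m * (f (b + 1) - f b) := by
  have slope : ∀ m : ℕ, b + m < N → f (b + m + 1) - f (b + m) ≤ f (b + 1) - f b := by
    intro m
    induction m with
    | zero => intro _; simp
    | succ m ih =>
      intro hm
      have h1 := h.slope_succ_le (x := b + (m + 1 : ℕ)) (by omega) hm
      have h2 := ih (by push_cast at hm; omega)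
      rw [show b + ((m + 1 : ℕ) : ℤ) - 1 = b + m by push_cast; ring] at h1
      rw [show b + ((m + 1 : ℕ) : ℤ) = b + m + 1 by push_cast; ring] at h1 ⊢
      linarith
  induction m with
  | zero => simp
  | succ m ih =>
    have h1 := ih (by push_cast at hm; omega)
    have h2 := slope m (by push_cast at hm; omega)
    rw [show b + ((m + 1 : ℕ) : ℤ) = b + m + 1 by push_cast; ring]
    push_cast
    linarith

theorem sub_slope_mul_ge {b : ℤ} (hb : b < N) (m : ℕ) (hm : m ≤ b) :
    f (b - m) ≤ f b - m * (f (b + 1) - f b) := by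
  rcases m.eq_zero_or_pos with rfl | hm0
  · simp
  have h1 := h.le_add_slope_mul (b := N - b) (by omega) m (by omega)
  have h2 := h.slope_succ_le (x := b) (by omega) hb
  rw [show N - b + m = N - (b - m) by ring, show N - b + 1 = N - (b - 1) by ring, h.symm, h.symm,
    h.symm] at h1
  have hm' : (0 : ℝ) ≤ m := m.cast_nonneg
  nlinarith

theorem tangent {b y : ℤ} (hb : 0 ≤ b) (hbN : b < N) (hy : 0 ≤ y) (hyN : y ≤ N) :
    f y ≤ f b + (y - b) * (f (b + 1) - f b) := by
  rcases le_total b y with hby | hby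
  · obtain ⟨m, hm⟩ := Int.eq_ofNat_of_zero_le (sub_nonneg.2 hby)
    obtain rfl : y = b + m := by omega
    have := h.le_add_slope_mul hb m hyN
    push_cast
    linarith
  · obtain ⟨m, hm⟩ := Int.eq_ofNat_of_zero_le (sub_nonneg.2 hby)
    obtain rfl : y = b - m := by omega
    have := h.sub_slope_mul_ge hbN m (by omega)
    push_cast
    linarith

/-- The slopes cancel when the tangent bounds from b at a and c are weighted by c - b and b - a. -/
theorem concave {a b c : ℤ} (ha : 0 ≤ a) (hab : a ≤ b) (hbc : b ≤ c) (hc : c ≤ N) :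
    ((c : ℝ) - b) * f a + (b - a) * f c ≤ (c - a) * f b := by
  rcases hbc.eq_or_lt with rfl | hbc
  · linarith
  have h1 := h.tangent (b := b) (y := a) (by omega) (by omega) ha (by omega)
  have h2 := h.tangent (b := b) (y := c) (by omega) (by omega) (by omega) hc
  have h3 : (0 : ℝ) ≤ c - b := sub_nonneg.2 (by exact_mod_cast hbc.le)
  have h4 : (0 : ℝ) ≤ b - a := sub_nonneg.2 (by exact_mod_cast hab)
  linarith [mul_le_mul_of_nonneg_left h1 h3, mul_le_mul_of_nonneg_left h2 h4]

/-- By symmetry the chord from i to N - i is horizontal, and concavity puts f above it. -/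
theorem le_of_central {i j : ℤ} (hij : i ≤ j) (hji : j ≤ N - i) : f i ≤ f j := by
  rcases lt_or_ge i 0 with hi | hi
  · rw [h.eq_zero i (by omega)]; exact h.nonneg j
  rcases (show i = N - i ∨ i < N - i by omega) with h0 | h0
  · obtain rfl : i = j := by omega
    rfl
  have h1 := h.concave hi hij hji (by omega)
  rw [h.symm] at h1
  have h2 : (0 : ℝ) < ((N - i : ℤ) : ℝ) - i := by
    have : (i : ℝ) < ((N - i : ℤ) : ℝ) := by exact_mod_cast h0
    linarith
  refine le_of_mul_le_mul_left ?_ h2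
  linarith

/-- The conditions at 1 and 2, with f 0 = 0 and f 1 ≤ f 3, give f 2 ≤ (C - 1) f 1 and 2 f 1 ≤ (C -
1) f 2. Hence (C - 1)² ≥ 2, that is C ≥ 1 + √2 > 7/3. -/
theorem seven_thirds_lt : 7 / 3 < C := by
  have h4 := h.four_le
  have h1 := h.three_le (x := 1) (by omega) (by omega)
  have h2 := h.three_le (x := 2) (by omega) (by omega)
  have h3 := h.le_of_central (i := 1) (j := 3) (by omega) (by omega)
  have p1 := h.pos 1 (by omega) (by omega)
  have p2 := h.pos 2 (by omega) (by omega)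
  norm_num at h1 h2
  rw [h.eq_zero 0 (by omega)] at h1
  by_contra! hC
  nlinarith

/-- Passing from radius k - 1 to k, the small ball gains f (k + 1) and the large one f (2k + 1) + f
(2k + 2). By symmetry both new points are nearly as close to the right end as k + 1 is to the left,
so the gain is below C f (k + 1). -/
theorem intervalSum_lt_of_le_right {k : ℤ} (hk : 1 ≤ k) (hN : N ≤ 3 * k + 3) :
    intervalSum f (1 - (2 * k + 1)) (1 + (2 * k + 1)) < C * intervalSum f (1 - k) (1 + k) := by
  have hC := h.seven_thirds_lt
  have h4 := h.four_le
  rcases lt_or_ge (1 + k) N with hkN | hkN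
  · have hle := h.le 1 (k - 1) (by omega) (by omega) (by omega)
    have e1 : intervalSum f (1 - k) (1 + k) = intervalSum f (1 - (k - 1)) (1 + (k - 1)) + f (k + 1) := by
      rw [h.clamp (1 - k), h.clamp (1 - (k - 1)), max_eq_left (by omega), max_eq_left (by omega),
        min_eq_right (by omega), min_eq_right (by omega), show 1 + k = k + 1 by ring,
        show 1 + (k - 1) = k by ring, intervalSum_succ_right f (by omega)]
    have e2 : intervalSum f (1 - (2 * k + 1)) (1 + (2 * k + 1)) =
        intervalSum f (1 - (2 * (k - 1) + 1)) (1 + (2 * (k - 1) + 1)) + f (2 * k + 1) +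
          f (2 * k + 2) := by
      have hz : ∀ a b : ℤ, a ≤ 1 → intervalSum f a b = intervalSum f 1 b := by
        intro a b ha
        rw [h.clamp a, h.clamp 1, max_eq_left ha, max_self]
      rw [hz (1 - (2 * k + 1)) _ (by omega), hz (1 - (2 * (k - 1) + 1)) _ (by omega),
        show 1 + (2 * k + 1) = 2 * k + 1 + 1 by ring,
        intervalSum_succ_right f (by omega), show 1 + (2 * (k - 1) + 1) = 2 * k by ring,
        intervalSum_succ_right f (by omega), show 2 * k + 1 + 1 = 2 * k + 2 by ring]
    have hp := h.pos (k + 1) (by omega) (by omega)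
    have hb : f (2 * k + 2) ≤ f (k + 1) := by
      have := h.le_of_central (i := N - (2 * k + 2)) (j := k + 1) (by omega) (by omega)
      rwa [h.symm] at this
    have hab : f (2 * k + 1) + f (2 * k + 2) < C * f (k + 1) := by
      -- At N = 3k + 3 the new points mirror k + 2 and k + 1, and the radius-0 condition at k + 1
      -- has f k > 0 to spare; for smaller N each new value is at most f (k + 1).
      rcases hN.eq_or_lt with hN | hN
      · have h3 := h.three_le (x := k + 1) (by omega) (by omega)
        rw [add_sub_cancel_right, ← h.symm (k + 1 + 1),
          show N - (k + 1 + 1) = 2 * k + 1 by omega] at h3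
        linarith [h.pos k (by omega) (by omega)]
      · have := h.le_of_central (i := N - (2 * k + 1)) (j := k + 1) (by omega) (by omega)
        rw [h.symm] at this
        nlinarith
    rw [e1, e2]
    linarith
  · have hp : 0 < intervalSum f (1 - k) (1 + k) := by
      have := h.mono (a := 1) (b := 1) (a' := 1 - k) (b' := 1 + k) (by omega) (by omega)
      rw [intervalSum_self] at this
      exact (h.pos 1 (by omega) (by omega)).trans_le this
    have he : intervalSum f (1 - (2 * k + 1)) (1 + (2 * k + 1)) = intervalSum f (1 - k) (1 + k) := by
      rw [h.clamp, h.clamp (1 - k), max_eq_left (by omega), max_eq_left (by omega),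
        min_eq_left (by omega), min_eq_left (by omega)]
    rw [he]
    nlinarith

/-- The chord l over the small ball lies below f inside and above f outside, so a bound of 7/3 for l
passes to f, and 7/3 < C. -/
theorem intervalSum_lt_of_interior {x k : ℤ} (hk : 1 ≤ k) (hx : k + 2 ≤ x)
    (hxN : x + k + 2 ≤ N) :
    intervalSum f (x - (2 * k + 1)) (x + (2 * k + 1)) < C * intervalSum f (x - k) (x + k) := by
  have hC := h.seven_thirds_lt
  have hk' : (1 : ℝ) ≤ k := by exact_mod_cast hk
  have hN' : (0 : ℝ) < N := by exact_mod_cast (by omega : 0 < N)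
  have hx1 : (k : ℝ) + 2 ≤ x := by exact_mod_cast hx
  have hx2 : (x : ℝ) + k + 2 ≤ N := by exact_mod_cast hxN
  -- the chord of `f` on `[x - k, x + k]`
  set u := f (x - k) with hu
  set v := f (x + k) with hv
  set β := (v - u) / (2 * k) with hβ
  have hβk : β * (2 * k) = v - u := div_mul_cancel₀ _ (by positivity)
  set q := (u - β * (x - k)) / N with hq
  set p := (u + β * (N - x + k)) / N with hp
  have hqN : q * N = u - β * (x - k) := div_mul_cancel₀ _ hN'.ne'
  have hpN : p * N = u + β * (N - x + k) := div_mul_cancel₀ _ hN'.ne'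
  have hpq : p - q = β := by
    have : (p - q) * N = β * N := by linarith
    exact mul_right_cancel₀ hN'.ne' this
  -- Since l ≥ f ≥ 0 at 0 and N, both coefficients are nonnegative; the bound for l reduces to that
  -- for the identity and its reflection.
  let l : ℤ → ℝ := fun y => p * (y : ℝ) + q * ((N - y : ℤ) : ℝ)
  have hl : ∀ y, l y = u + β * (y - x + k) := by
    intro y
    simp only [l]
    push_cast
    linear_combination hqN + (y : ℝ) * hpq
  have inside : ∀ y, x - k ≤ y → y ≤ x + k → l y ≤ f y := by
    intro y h1 h2
    have := h.concave (a := x - k) (b := y) (c := x + k) (by omega) h1 h2 (by omega)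
    push_cast at this
    rw [← hu, ← hv] at this
    rw [hl]
    refine le_of_mul_le_mul_left ?_ (by positivity : (0 : ℝ) < 2 * k)
    linear_combination this + (y - x + k : ℝ) * hβk
  have outside : ∀ y, 0 ≤ y → y ≤ N → (y ≤ x - k ∨ x + k ≤ y) → f y ≤ l y := by
    intro y h1 h2 h3
    rw [hl]
    refine le_of_mul_le_mul_left ?_ (by positivity : (0 : ℝ) < 2 * k)
    rcases h3 with h3 | h3
    · have := h.concave (a := y) (b := x - k) (c := x + k) h1 h3 (by omega) (by omega)
      push_cast at this
      rw [← hu, ← hv] at this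
      linear_combination this - (y - x + k : ℝ) * hβk
    · have := h.concave (a := x - k) (b := x + k) (c := y) (by omega) (by omega) h3 h2
      push_cast at this
      rw [← hu, ← hv] at this
      linear_combination this - (y - x + k : ℝ) * hβk
  have hq0 : 0 ≤ q := by
    have := (h.nonneg 0).trans (outside 0 le_rfl (by omega) (by omega))
    simp only [l] at this
    push_cast at this
    exact nonneg_of_mul_nonneg_left (by linarith) hN'
  have hp0 : 0 ≤ p := by
    have := (h.nonneg N).trans (outside N (by omega) le_rfl (by omega))
    simp only [l] at this
    push_cast at this
    exact nonneg_of_mul_nonneg_left (by linarith) hN'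
  set L := max 1 (x - (2 * k + 1)) with hL
  set U := min (N - 1) (x + (2 * k + 1)) with hU
  -- the part of the sums of `l` outside the small ball is bounded
  have hsplit : ∀ g : ℤ → ℝ, intervalSum g L U = intervalSum g (x - k) (x + k) +
      ∑ y ∈ Finset.Icc L U \ Finset.Icc (x - k) (x + k), g y := by
    intro g
    rw [add_comm]
    exact (Finset.sum_sdiff (Finset.Icc_subset_Icc (by omega) (by omega))).symm
  have hout : ∑ y ∈ Finset.Icc L U \ Finset.Icc (x - k) (x + k), f y ≤
      ∑ y ∈ Finset.Icc L U \ Finset.Icc (x - k) (x + k), l y := by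
    refine Finset.sum_le_sum fun y hy => ?_
    rw [Finset.mem_sdiff, Finset.mem_Icc, Finset.mem_Icc] at hy
    exact outside y (by omega) (by omega) (by omega)
  have hin : intervalSum l (x - k) (x + k) ≤ intervalSum f (x - k) (x + k) := intervalSum_mono inside
  have hball : intervalSum l (x - k) (x + k) = (2 * k + 1) * (p * x + q * (N - x)) := by
    simp only [l]
    rw [intervalSum_linear, intervalSum_reflect (fun y => (y : ℝ)), intervalSum_cast (by omega),
      intervalSum_cast (by omega)]
    push_cast
    ring
  have hbig : intervalSum l L U ≤ 7 / 3 * intervalSum l (x - k) (x + k) := by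
    rw [hball]
    simp only [l]
    rw [intervalSum_linear, intervalSum_reflect (fun y => (y : ℝ))]
    have i1 : intervalSum (fun y => (y : ℝ)) L U ≤ 7 / 3 * ((2 * k + 1) * x) := by
      refine (intervalSum_mono_set le_rfl (min_le_right _ _) fun y hy _ => ?_).trans
        (intervalSum_cast_le hk hx)
      exact_mod_cast (by omega : 0 ≤ y)
    have i2 : intervalSum (fun y => (y : ℝ)) (N - U) (N - L) ≤
        7 / 3 * ((2 * k + 1) * ((N - x : ℤ) : ℝ)) := by
      refine (intervalSum_mono_set (by omega) (by omega) fun y hy _ => ?_).trans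
        (intervalSum_cast_le (x := N - x) hk (by omega))
      exact_mod_cast (by omega : 0 ≤ y)
    push_cast at i2
    linear_combination mul_le_mul_of_nonneg_left i1 hp0 + mul_le_mul_of_nonneg_left i2 hq0
  have hfpos : 0 < intervalSum f (x - k) (x + k) := by
    have := h.mono (a := x) (b := x) (a' := x - k) (b' := x + k) (by omega) (by omega)
    rw [intervalSum_self] at this
    exact (h.pos x (by omega) (by omega)).trans_le this
  rw [h.clamp (x - (2 * k + 1)), ← hL, ← hU]
  have s1 := hsplit f
  have s2 := hsplit l
  nlinarith

theorem intervalSum_symm (a b : ℤ) : intervalSum f (N - b) (N - a) = intervalSum f a b := by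
  rw [← intervalSum_reflect]
  simp only [h.symm]

/-- A small ball reaching the left end is also the ball of radius x + k - 1 about 1, whose doubled
ball [1, 2x + 2k] goes beyond x + 2k + 1 because x ≥ 2. The right end follows by reflection. -/
theorem intervalSum_lt {x k : ℤ} (hk : 1 ≤ k) (hx : 2 ≤ x) (hxN : x + 2 ≤ N) :
    intervalSum f (x - (2 * k + 1)) (x + (2 * k + 1)) < C * intervalSum f (x - k) (x + k) := by
  have left : ∀ x, 2 ≤ x → x + 2 ≤ N → x ≤ k + 1 →
      intervalSum f (x - (2 * k + 1)) (x + (2 * k + 1)) < C * intervalSum f (x - k) (x + k) := by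
    intro x hx hxN hxk
    have hz : ∀ a b : ℤ, a ≤ 1 → intervalSum f a b = intervalSum f 1 b := by
      intro a b ha
      rw [h.clamp a, h.clamp 1, max_eq_left ha, max_self]
    have e1 : intervalSum f (x - k) (x + k) =
        intervalSum f (1 - (x + k - 1)) (1 + (x + k - 1)) := by
      rw [hz _ _ (by omega), hz (1 - (x + k - 1)) _ (by omega)]
      congr 1; ring
    have e2 : intervalSum f (x - (2 * k + 1)) (x + (2 * k + 1)) = intervalSum f 1 (x + 2 * k + 1) := by
      rw [hz _ _ (by omega)]
      congr 1; ring
    have e3 : intervalSum f (1 - (2 * (x + k - 1) + 1)) (1 + (2 * (x + k - 1) + 1)) =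
        intervalSum f 1 (2 * x + 2 * k) := by
      rw [hz _ _ (by omega)]
      congr 1; ring
    rw [e1, e2]
    -- Either the point x + 2k + 2 carries mass and gives strictness, or N ≤ x + 2k + 2 and the end
    -- ball is itself not tight.
    rcases lt_or_ge (x + 2 * k + 2) N with hN | hN
    · have hle := h.le 1 (x + k - 1) (by omega) (by omega) (by omega)
      have h2 := h.mono (a := 1) (b := x + 2 * k + 1 + 1) (a' := 1) (b' := 2 * x + 2 * k) le_rfl
        (by omega)
      rw [intervalSum_succ_right f (by omega)] at h2
      have hp := h.pos (x + 2 * k + 1 + 1) (by omega) (by omega)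
      rw [e3] at hle
      linarith
    · have hlt := h.intervalSum_lt_of_le_right (k := x + k - 1) (by omega) (by omega)
      rw [e3] at hlt
      exact (h.mono le_rfl (by omega)).trans_lt hlt
  rcases le_or_gt x (k + 1) with h1 | h1
  · exact left x hx hxN h1
  rcases le_or_gt (N - x) (k + 1) with h2 | h2
  · have := left (N - x) (by omega) (by omega) h2
    rw [show N - x - (2 * k + 1) = N - (x + (2 * k + 1)) by ring,
      show N - x + (2 * k + 1) = N - (x - (2 * k + 1)) by ring, h.intervalSum_symm,
      show N - x - k = N - (x + k) by ring, show N - x + k = N - (x - k) by ring,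
      h.intervalSum_symm] at this
    exact this
  exact h.intervalSum_lt_of_interior hk (by omega) (by omega)

end SymmFeasible

/-! ### Path distances and the tight balls of symmetric minimizers -/

section Path

open SimpleGraph

variable {n : ℕ}

theorem natAbs_sub_le_length {x y : Fin n} (w : (pathGraph n).Walk x y) :
    ((x : ℤ) - y).natAbs ≤ w.length := by
  induction w with
  | nil => simp
  | cons hadj w ih =>
    rw [pathGraph_adj] at hadj
    rw [Walk.length_cons]
    omega

theorem dist_pathGraph_le (x y : Fin n) (h : x ≤ y) : (pathGraph n).dist x y ≤ y - x := by
  obtain ⟨m, hm⟩ := Nat.exists_eq_add_of_le (Fin.le_def.1 h)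
  have hy := y.2
  induction m generalizing y with
  | zero =>
    obtain rfl : y = x := Fin.ext (by omega)
    simp
  | succ m ih =>
    let z : Fin n := ⟨x + m, by omega⟩
    have hz : (z : ℕ) = x + m := rfl
    have h1 := ih z (Fin.le_def.2 (by omega)) hz z.2
    have h2 : (pathGraph n).dist z y = 1 :=
      dist_eq_one_iff_adj.2 (pathGraph_adj.2 (Or.inl (by omega)))
    have h3 := (pathGraph_preconnected n x z).dist_triangle_left y
    omega

theorem dist_pathGraph (x y : Fin n) : (pathGraph n).dist x y = ((x : ℤ) - y).natAbs := by
  obtain ⟨w, hw⟩ := (pathGraph_preconnected n x y).exists_walk_length_eq_dist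
  have h1 := natAbs_sub_le_length w
  rcases le_total x y with h | h
  · have h2 := dist_pathGraph_le x y h
    have h3 := Fin.le_def.1 h
    omega
  · have h2 := dist_pathGraph_le y x h
    have h3 := Fin.le_def.1 h
    rw [dist_comm] at h2
    omega

/-- The extension by zero to the integers of a weight function on the path `1, …, n`. -/
noncomputable def extendZero (μ : Fin n → ℝ) (y : ℤ) : ℝ :=
  if h : 0 < y ∧ y < n + 1 then μ ⟨(y - 1).toNat, by omega⟩ else 0

theorem extendZero_val (μ : Fin n → ℝ) (i : Fin n) : extendZero μ (i + 1) = μ i := by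
  rw [extendZero, dif_pos (by omega)]
  congr 1
  ext
  simp

theorem exists_val_add_one_eq {y : ℤ} (h0 : 0 < y) (h1 : y < n + 1) :
    ∃ i : Fin n, (i : ℤ) + 1 = y :=
  ⟨⟨(y - 1).toNat, by omega⟩, by simp only []; omega⟩

theorem extendZero_of_notMem (μ : Fin n → ℝ) {y : ℤ} (h : y ≤ 0 ∨ (n : ℤ) + 1 ≤ y) :
    extendZero μ y = 0 :=
  dif_neg (by omega)

theorem extendZero_restrict (g : ℤ → ℝ) {y : ℤ} (h0 : 0 < y) (h1 : y < n + 1) :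
    extendZero (fun i : Fin n => g (i + 1)) y = g y := by
  obtain ⟨i, rfl⟩ := exists_val_add_one_eq h0 h1
  exact extendZero_val _ i

theorem extendZero_reflect (μ : Fin n → ℝ) (y : ℤ) :
    extendZero μ (n + 1 - y) = extendZero (μ ∘ Fin.rev) y := by
  by_cases h : 0 < y ∧ y < n + 1
  · obtain ⟨i, rfl⟩ := exists_val_add_one_eq h.1 h.2
    rw [extendZero_val, Function.comp_apply, ← extendZero_val μ i.rev]
    congr 1
    rw [Fin.val_rev]
    omega
  · rw [extendZero_of_notMem _ (by omega), extendZero_of_notMem _ (by omega)]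

theorem mass_closedBall_pathGraph (μ : Fin n → ℝ) (x : Fin n) (k : ℕ) :
    mass μ (closedBall (pathGraph n) x k) =
      intervalSum (extendZero μ) ((x : ℤ) + 1 - k) ((x : ℤ) + 1 + k) := by
  classical
  have h1 : mass μ (closedBall (pathGraph n) x k) =
      ∑ i ∈ Finset.univ.filter (· ∈ closedBall (pathGraph n) x k), μ i := by
    rw [Finset.sum_filter, mass]
    refine Finset.sum_congr rfl fun i _ => ?_
    rw [Set.indicator_apply]
  rw [h1, intervalSum]
  have hmem : ∀ i, i ∈ closedBall (pathGraph n) x k ↔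
      (i : ℤ) + 1 ∈ Finset.Icc ((x : ℤ) + 1 - k) ((x : ℤ) + 1 + k) := by
    intro i
    rw [closedBall, Set.mem_ofPred_eq, dist_pathGraph, Finset.mem_Icc]
    omega
  refine Finset.sum_of_injOn (fun i : Fin n => (i : ℤ) + 1) ?_ ?_ ?_ ?_
  · intro i _ j _ hij
    exact Fin.ext (by simp only [] at hij; omega)
  · intro i hi
    simpa [hmem] using hi
  · intro y hy hy'
    by_contra h0
    by_cases h : 0 < y ∧ y < n + 1
    · obtain ⟨i, rfl⟩ := exists_val_add_one_eq h.1 h.2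
      exact hy' ⟨i, by simpa [hmem] using hy, rfl⟩
    · exact h0 (extendZero_of_notMem _ (by omega))
  · intro i _
    exact (extendZero_val μ i).symm

theorem mass_closedBall_zero (μ : Fin n → ℝ) (x : Fin n) :
    mass μ (closedBall (pathGraph n) x 0) = μ x := by
  rw [mass_closedBall_pathGraph]
  simp [intervalSum_self, extendZero_val]

theorem mass_restrict_closedBall_one (g : ℤ → ℝ) (x : Fin n) (h0 : 1 ≤ (x : ℕ))
    (h1 : (x : ℕ) + 2 ≤ n) :
    mass (fun i : Fin n => g (i + 1)) (closedBall (pathGraph n) x 1) =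
      g x + g (x + 1) + g (x + 2) := by
  rw [mass_closedBall_pathGraph, Nat.cast_one, intervalSum_three,
    extendZero_restrict _ (by omega) (by omega), extendZero_restrict _ (by omega) (by omega),
    extendZero_restrict _ (by omega) (by omega), add_sub_cancel_right, add_assoc (x : ℤ) 1 1]
  rfl

theorem mass_one_closedBall (x : Fin n) (k : ℕ) :
    ∃ m : ℤ, m = min (n : ℤ) (x + 1 + k) + 1 - max 1 ((x : ℤ) + 1 - k) ∧
      mass (fun _ : Fin n => (1 : ℝ)) (closedBall (pathGraph n) x k) = m := by
  refine ⟨_, rfl, ?_⟩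
  rw [mass_closedBall_pathGraph, intervalSum]
  have hs : Finset.Icc (max 1 ((x : ℤ) + 1 - k)) (min (n : ℤ) (x + 1 + k)) ⊆
      Finset.Icc ((x : ℤ) + 1 - k) (x + 1 + k) :=
    Finset.Icc_subset_Icc (le_max_right _ _) (min_le_right _ _)
  rw [← Finset.sum_subset hs]
  · rw [Finset.sum_congr rfl (g := fun _ => (1 : ℝ))]
    · rw [Finset.sum_const, Int.card_Icc, nsmul_eq_mul, mul_one, ← Int.cast_natCast,
        Int.toNat_of_nonneg (by omega)]
    · intro y hy
      rw [Finset.mem_Icc] at hy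
      exact extendZero_restrict (fun _ => (1 : ℝ)) (by omega) (by omega)
  · intro y hy hy'
    rw [Finset.mem_Icc] at hy hy'
    exact extendZero_of_notMem _ (by omega)

/-- If C were at least 3, the uniform weight would be a minimizer whose only tight balls are
interior of radius 0; the strictly concave direction -y² relaxes all of these. -/
theorem leastDoublingConst_pathGraph_lt_three (hn : 3 ≤ n) :
    leastDoublingConst (pathGraph n) < 3 := by
  have : Nonempty (Fin n) := ⟨⟨0, by omega⟩⟩
  by_contra! hC
  have hcount : ∀ (x : Fin n) (k : ℕ),
      mass (fun _ : Fin n => (1 : ℝ)) (closedBall (pathGraph n) x (2 * k + 1)) ≤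
        3 * mass (fun _ : Fin n => (1 : ℝ)) (closedBall (pathGraph n) x k) := by
    intro x k
    obtain ⟨a, ha, ha'⟩ := mass_one_closedBall x (2 * k + 1)
    obtain ⟨b, hb, hb'⟩ := mass_one_closedBall x k
    rw [ha', hb']
    have hx := x.2
    push_cast at ha
    exact_mod_cast (by omega : a ≤ 3 * b)
  have h3 : leastDoublingConst (pathGraph n) = 3 :=
    ((leastDoublingConst_le fun _ => one_pos).trans
      (doublingConst_le (fun _ => one_pos) hcount)).antisymm hC
  have hmin : IsDoublingMinimizer (pathGraph n) (fun _ => (1 : ℝ)) :=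
    isDoublingMinimizer_of_le (fun _ => one_pos) (h3 ▸ hcount)
  let g : ℤ → ℝ := fun y => -(y : ℝ) ^ 2
  obtain ⟨x, k, ht, hle⟩ :=
    hmin.exists_isTight_le (fun i : Fin n => g (i + 1))
  unfold IsTight at ht
  rw [h3] at ht hle
  obtain ⟨a, ha, ha'⟩ := mass_one_closedBall x (2 * k + 1)
  obtain ⟨b, hb, hb'⟩ := mass_one_closedBall x k
  rw [ha', hb'] at ht
  norm_cast at ht
  push_cast at ha
  have hx := x.2
  obtain rfl : k = 0 := by omega
  rw [mass_closedBall_zero, mul_zero, zero_add,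
    mass_restrict_closedBall_one g _ (by omega) (by omega)] at hle
  simp only [g] at hle
  push_cast at hle
  nlinarith

theorem dist_pathGraph_rev (x y : Fin n) :
    (pathGraph n).dist (Fin.revPerm x) (Fin.revPerm y) = (pathGraph n).dist x y := by
  rw [dist_pathGraph, dist_pathGraph, Fin.revPerm_apply, Fin.revPerm_apply, Fin.val_rev,
    Fin.val_rev]
  omega

theorem isTight_rev {μ : Fin n → ℝ} (hs : μ ∘ Fin.rev = μ) {x : Fin n} {k : ℕ}
    (h : IsTight (pathGraph n) μ x k) : IsTight (pathGraph n) μ x.rev k := by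
  unfold IsTight at *
  have e := fun k => mass_comp Fin.revPerm dist_pathGraph_rev μ x k
  rw [show μ ∘ ⇑Fin.revPerm = μ from hs] at e
  rw [e, e] at h
  exact h

theorem symmFeasible_extendZero (hn : 3 ≤ n) {μ : Fin n → ℝ}
    (hμ : IsDoublingMinimizer (pathGraph n) μ) (hs : μ ∘ Fin.rev = μ) :
    SymmFeasible (n + 1) (leastDoublingConst (pathGraph n)) (extendZero μ) where
  four_le := by omega
  le_three := (leastDoublingConst_pathGraph_lt_three hn).le
  pos y h0 h1 := by
    obtain ⟨i, rfl⟩ := exists_val_add_one_eq h0 h1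
    rw [extendZero_val]
    exact hμ.1.pos i
  eq_zero y hy := extendZero_of_notMem _ hy
  symm y := by rw [extendZero_reflect, hs]
  le x k h0 h1 hk := by
    obtain ⟨i, rfl⟩ := exists_val_add_one_eq h0 h1
    obtain ⟨k, rfl⟩ := Int.eq_ofNat_of_zero_le hk
    have := hμ.mass_le i k
    rw [mass_closedBall_pathGraph, mass_closedBall_pathGraph] at this
    push_cast at this
    exact this

/-- A symmetric minimizer has tight balls only of radius `0` at interior vertices, and
of small radius at the end vertices. -/
theorem IsTight.cases (hn : 3 ≤ n) {μ : Fin n → ℝ}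
    (hμ : IsDoublingMinimizer (pathGraph n) μ) (hs : μ ∘ Fin.rev = μ) {x : Fin n} {k : ℕ}
    (h : IsTight (pathGraph n) μ x k) :
    (1 ≤ (x : ℕ) ∧ (x : ℕ) + 2 ≤ n ∧ k = 0) ∨
      (((x : ℕ) = 0 ∨ (x : ℕ) + 1 = n) ∧ 3 * k + 2 < n) := by
  have hf := symmFeasible_extendZero hn hμ hs
  have left : ∀ x : Fin n, (x : ℕ) = 0 → IsTight (pathGraph n) μ x k → 3 * k + 2 < n := by
    intro x hx h
    by_contra! hk
    have := hf.intervalSum_lt_of_le_right (k := k) (by omega) (by omega)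
    unfold IsTight at h
    rw [mass_closedBall_pathGraph, mass_closedBall_pathGraph, hx] at h
    push_cast at h
    exact this.ne h
  have hx := x.2
  rcases (show (x : ℕ) = 0 ∨ (x : ℕ) + 1 = n ∨ (1 ≤ (x : ℕ) ∧ (x : ℕ) + 2 ≤ n) by omega) with
    h0 | h0 | h0
  · exact Or.inr ⟨Or.inl h0, left x h0 h⟩
  · exact Or.inr ⟨Or.inr h0, left x.rev (by rw [Fin.val_rev]; omega) (isTight_rev hs h)⟩
  · refine Or.inl ⟨h0.1, h0.2, ?_⟩
    by_contra hk
    have := hf.intervalSum_lt (x := x + 1) (k := k) (by omega) (by omega) (by omega)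
    unfold IsTight at h
    rw [mass_closedBall_pathGraph, mass_closedBall_pathGraph] at h
    push_cast at h
    exact this.ne h

theorem exists_isTight_interior (hn : 3 ≤ n) {μ : Fin n → ℝ}
    (hμ : IsDoublingMinimizer (pathGraph n) μ) (hs : μ ∘ Fin.rev = μ) :
    ∃ x : Fin n, 1 ≤ (x : ℕ) ∧ (x : ℕ) + 2 ≤ n ∧ IsTight (pathGraph n) μ x 0 := by
  have : Nonempty (Fin n) := ⟨⟨0, by omega⟩⟩
  -- For an end ball with 3k + 2 < n, neither it nor its double reaches the other end, so both gain
  -- 1; since C > 1, the condition is relaxed.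
  let g : ℤ → ℝ := fun y => if y = 1 ∨ y = n then 1 else 0
  obtain ⟨x, k, ht, hle⟩ := hμ.exists_isTight_le (fun i : Fin n => g (i + 1))
  rcases ht.cases hn hμ hs with ⟨h1, h2, rfl⟩ | ⟨hx, hk⟩
  · exact ⟨x, h1, h2, ht⟩
  have hone : ∀ m : ℕ, m + 1 < n →
      mass (fun i : Fin n => g (i + 1)) (closedBall (pathGraph n) x m) = 1 := by
    intro m hm
    rw [mass_closedBall_pathGraph, intervalSum, Finset.sum_eq_single ((x : ℤ) + 1)]
    · rw [extendZero_restrict _ (by omega) (by omega)]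
      exact if_pos (by omega)
    · intro y hy hyx
      rw [Finset.mem_Icc] at hy
      by_cases h : 0 < y ∧ y < n + 1
      · rw [extendZero_restrict _ h.1 h.2]
        exact if_neg (by omega)
      · exact extendZero_of_notMem _ (by omega)
    · intro h
      exact absurd (Finset.mem_Icc.2 (by omega)) h
  rw [hone _ (by omega), hone _ (by omega)] at hle
  linarith [(symmFeasible_extendZero hn hμ hs).seven_thirds_lt]

theorem exists_isTight_end (hn : 3 ≤ n) {μ : Fin n → ℝ}
    (hμ : IsDoublingMinimizer (pathGraph n) μ) (hs : μ ∘ Fin.rev = μ) :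
    ∃ (x : Fin n) (k : ℕ), (x : ℕ) = 0 ∧ 3 * k + 2 < n ∧ IsTight (pathGraph n) μ x k := by
  have : Nonempty (Fin n) := ⟨⟨0, by omega⟩⟩
  -- An interior condition of radius 0 changes by 3 - C > 0 in its favour.
  let g : ℤ → ℝ := fun _ => -1
  obtain ⟨x, k, ht, hle⟩ := hμ.exists_isTight_le (fun i : Fin n => g (i + 1))
  rcases ht.cases hn hμ hs with ⟨h1, h2, rfl⟩ | ⟨hx, hk⟩
  · rw [mass_closedBall_zero, mul_zero, zero_add, mass_restrict_closedBall_one g _ h1 h2] at hle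
    simp only [g] at hle
    linarith [leastDoublingConst_pathGraph_lt_three hn]
  · rcases hx with hx | hx
    · exact ⟨x, k, hx, hk, ht⟩
    · exact ⟨x.rev, k, by rw [Fin.val_rev]; omega, hk, isTight_rev hs ht⟩

end Path

end PathDoubling

/- `SimpleGraph.pathGraph n` has vertex set `Fin n = {0, …, n - 1}`, consecutive vertices being
adjacent; the vertex `i : Fin n` is the vertex number `i + 1` of the path `L_n` on `{1, …, n}`. -/
theorem theorem6p7 (n : ℕ) (hn : 3 ≤ n) :
    ∃ (j : Fin n) (k : ℕ),
      2 ≤ (j : ℕ) + 1 ∧ (((j : ℕ) + 1 : ℕ) : ℤ) ≤ ⌈(n : ℝ) / 2⌉ ∧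
      (k : ℤ) < ⌈((n : ℝ) - 2) / 3⌉ ∧
      ∀ μ : Fin n → ℝ,
        PathDoubling.IsDoublingMinimizer (SimpleGraph.pathGraph n) μ →
          PathDoubling.mass μ (PathDoubling.closedBall (SimpleGraph.pathGraph n) j 1) / μ j
              = PathDoubling.doublingConst (SimpleGraph.pathGraph n) μ ∧
          PathDoubling.mass μ
                (PathDoubling.closedBall (SimpleGraph.pathGraph n) ⟨0, by omega⟩ (2 * k + 1)) /
              PathDoubling.mass μ
                (PathDoubling.closedBall (SimpleGraph.pathGraph n) ⟨0, by omega⟩ k)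
              = PathDoubling.doublingConst (SimpleGraph.pathGraph n) μ := by
  open PathDoubling SimpleGraph in
  have : Nonempty (Fin n) := ⟨⟨0, by omega⟩⟩
  by_cases hex : ∃ μ, IsDoublingMinimizer (pathGraph n) μ
  swap
  -- Existence of minimizers is not needed: without any, every admissible pair works vacuously.
  · refine ⟨⟨1, by omega⟩, 0, le_rfl, ?_, ?_, fun μ hμ => absurd ⟨μ, hμ⟩ hex⟩
    · rw [Int.le_ceil_iff]
      have : (3 : ℝ) ≤ n := by exact_mod_cast hn
      push_cast
      linarith
    · rw [Int.lt_ceil]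
      have : (3 : ℝ) ≤ n := by exact_mod_cast hn
      push_cast
      linarith
  obtain ⟨μ₀, hμ₀⟩ := hex
  obtain ⟨μ₁, hμ₁, hleast⟩ := exists_isTight_imp hμ₀
  have hrev : IsDoublingMinimizer (pathGraph n) (μ₁ ∘ Fin.revPerm) :=
    hμ₁.comp Fin.revPerm dist_pathGraph_rev
  have hμ : IsDoublingMinimizer (pathGraph n) (μ₁ + μ₁ ∘ Fin.revPerm) := hμ₁.add hrev
  have hs : (μ₁ + μ₁ ∘ Fin.revPerm) ∘ Fin.rev = μ₁ + μ₁ ∘ Fin.revPerm := by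
    ext i
    simp [add_comm]
  have hall : ∀ ν, IsDoublingMinimizer (pathGraph n) ν → ∀ x k,
      IsTight (pathGraph n) (μ₁ + μ₁ ∘ Fin.revPerm) x k → IsTight (pathGraph n) ν x k :=
    fun ν hν x k h => hleast ν hν x k (hμ₁.isTight_of_add hrev h).1
  obtain ⟨x₀, k, hx₀, hk, htk⟩ := exists_isTight_end hn hμ hs
  rw [show x₀ = ⟨0, by omega⟩ from Fin.ext hx₀] at htk
  obtain ⟨j, hj1, hj2, htj⟩ : ∃ j : Fin n, 1 ≤ (j : ℕ) ∧ 2 * ((j : ℕ) + 1) ≤ n + 1 ∧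
      IsTight (pathGraph n) (μ₁ + μ₁ ∘ Fin.revPerm) j 0 := by
    obtain ⟨x, h1, h2, ht⟩ := exists_isTight_interior hn hμ hs
    rcases le_total (2 * ((x : ℕ) + 1)) (n + 1) with h | h
    · exact ⟨x, h1, h, ht⟩
    -- Symmetry moves the tight vertex into the left half.
    · exact ⟨x.rev, by rw [Fin.val_rev]; omega, by rw [Fin.val_rev]; omega, isTight_rev hs ht⟩
  refine ⟨j, k, by omega, ?_, ?_, fun ν hν => ⟨?_, hν.div_eq_of_isTight (hall ν hν _ _ htk)⟩⟩
  · rw [Int.le_ceil_iff]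
    have : 2 * ((j : ℝ) + 1) ≤ n + 1 := by exact_mod_cast hj2
    push_cast
    linarith
  · rw [Int.lt_ceil]
    have : 3 * (k : ℝ) + 2 < n := by exact_mod_cast hk
    push_cast
    linarith
  · have := hν.div_eq_of_isTight (hall ν hν _ _ htj)
    rwa [mass_closedBall_zero] at this
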